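/- Let $H$ be an infinite-dimensional complex Hilbert space (not necessarily separable) and $\mathcal B(H)$ the algebra of bounded linear operators on $H$. A quasi-norm on a real or complex vector space $X$ is a function $\|\cdot\|:X\to[0,\infty)$ with $\|x\|=0\Leftrightarrow x=0$, $\|\alpha x\|=|\alpha|\|x\|$ and $\|x+y\|\le C(\|x\|+\|y\|)$ for some constant $C\ge 1$; the least such $C\ge 1$ is its modulus of concavity. It is complete if every Cauchy sequence with respect to $\|\cdot\|$ converges. For a compact operator $x$ let $s(x)=\{s_n(x)\}_{n=1}^\infty$ be its singular values, i.e. the eigenvalues of $|x|=(x^*x)^{1/2}$ in decreasing order, repeated according to multiplicity (and followed by zeros if $x$ has finite rank). For a bounded real sequence $\xi$ let $\xi^*$ be the decreasing rearrangement of $|\xi|$, i.e. $\xi_n^*=\inf\{t\ge 0:\#\{k:|\xi_k|>t\}\le n-1\}$ for $n\ge1$. A symmetric quasi-Banach ideal of compact operators is a nonzero two-sided ideal $\mathcal I$ of $\mathcal B(H)$ consisting of compact operators, with a complete quasi-norm $\|\cdot\|_{\mathcal I}$ such that $\|axb\|_{\mathcal I}\le\|a\|\,\|x\|_{\mathcal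 I}\|b\|$ for all $x\in\mathcal I$, $a,b\in\mathcal B(H)$, and $\|p\|_{\mathcal I}=1$ for every one-dimensional orthogonal projection $p\in\mathcal I$. A symmetric quasi-Banach sequence space is a nonzero real linear subspace $E\subset l_\infty$ such that $\eta\in E$, $\xi\in l_\infty$, $\xi^*\le\eta^*$ imply $\xi\in E$, with a complete quasi-norm $\|\cdot\|_E$ such that $\|\xi\|_E\le\|\eta\|_E$ whenever $\xi,\eta\in E$, $\xi^*\le\eta^*$, and $\|(1,0,0,\dots)\|_E=1$. For such $E$ put $C_E=\{x\in\mathcal B(H): x\text{ compact},\ s(x)\in E\}$ and $\|x\|_{C_E}=\|s(x)\|_E$. **Theorem.** Let $(\mathcal I,\|\cdot\|_{\mathcal I})$ be a symmetric quasi-Banach ideal of compact operators on $H$. Let $E_{\mathcal I}$ be the set of all real null sequences $\xi\in c_0$ such that $\xi^*=s(x)$ for some $x\in\mathcal I$, and put $\|\xi\|_{E_{\mathcal I}}=\|x\|_{\mathcal I}$ for any $x\in\mathcal I$ with $\xi^*=s(x)$. Then $\|\cdot\|_{E_{\mathcal I}}$ is well defined, $(E_{\mathcal I},\|\cdot\|_{E_{\mathcal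 I}})$ is a symmetric quasi-Banach sequence space contained in $c_0$, and its modulus of concavity does not exceed that of $\|\cdot\|_{\mathcal I}$. Moreover $C_{E_{\mathcal I}}=\mathcal I$ and $\|x\|_{C_{E_{\mathcal I}}}=\|x\|_{\mathcal I}$ for all $x\in\mathcal I$. -/

import Mathlib

open Filter Topology
open scoped ENNReal

noncomputable section

/-! ## Quasi-norms -/

/-- A quasi-norm on a vector space `X` over `𝕜` (the real or the complex numbers). -/
structure IsQuasiNorm (𝕜 : Type*) [RCLike 𝕜] {X : Type*} [AddCommGroup X] [Module 𝕜 X]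
    (q : X → ℝ) : Prop where
  nonneg : ∀ x, 0 ≤ q x
  eq_zero_iff : ∀ x, q x = 0 ↔ x = 0
  smul : ∀ (c : 𝕜) (x : X), q (c • x) = ‖c‖ * q x
  add_le : ∃ C : ℝ, 1 ≤ C ∧ ∀ x y, q (x + y) ≤ C * (q x + q y)

/-- The modulus of concavity: the least constant `C ≥ 1` in the quasi-triangle inequality.
(For a quasi-norm the set below is non-empty, closed and bounded below, so the infimum is
attained.) -/
def modulusOfConcavity {X : Type*} [AddCommGroup X] (q : X → ℝ) : ℝ :=
  sInf {C : ℝ | 1 ≤ C ∧ ∀ x y, q (x + y) ≤ C * (q x + q y)}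

/-- Completeness of a quasi-norm: every Cauchy sequence converges. -/
def IsCompleteQuasiNorm {X : Type*} [AddCommGroup X] (q : X → ℝ) : Prop :=
  ∀ u : ℕ → X, (∀ ε : ℝ, 0 < ε → ∃ n₀ : ℕ, ∀ m n, n₀ ≤ m → n₀ ≤ n → q (u m - u n) < ε) →
    ∃ x : X, Tendsto (fun n => q (u n - x)) atTop (𝓝 0)

/-! ## Sequences (indexed from `0`) -/

/-- The decreasing rearrangement `ξ*` of the sequence `|ξ|`, for a bounded sequence `ξ`:
`ξ*_n` is the infimum of the levels `t ≥ 0` that are exceeded by at most `n` of the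
numbers `|ξ_k|`. -/
def decrRearrangement (ξ : ℕ → ℝ) (n : ℕ) : ℝ :=
  sInf {t : ℝ | 0 ≤ t ∧ {k : ℕ | t < |ξ k|}.encard ≤ n}

/-- A symmetric quasi-Banach sequence space: a nonzero solid rearrangement-invariant linear
subspace `E` of the space of bounded real sequences, with a complete quasi-norm that is
monotone with respect to decreasing rearrangements and normalized at `(1, 0, 0, …)`. -/
structure IsSymmetricQuasiBanachSequenceSpace (E : Submodule ℝ (ℕ → ℝ)) (N : E → ℝ) :
    Prop where
  bounded : ∀ ξ ∈ E, Memℓp ξ ∞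
  ne_bot : E ≠ ⊥
  solid : ∀ η ∈ E, ∀ ξ : ℕ → ℝ, Memℓp ξ ∞ →
    decrRearrangement ξ ≤ decrRearrangement η → ξ ∈ E
  quasiNorm : IsQuasiNorm ℝ N
  complete : IsCompleteQuasiNorm N
  mono : ∀ ξ η : E, decrRearrangement ξ ≤ decrRearrangement η → N ξ ≤ N η
  normalized : ∃ h : (Pi.single 0 1 : ℕ → ℝ) ∈ E, N ⟨Pi.single 0 1, h⟩ = 1

/-! ## Operators on a Hilbert space -/

variable {H : Type*} [NormedAddCommGroup H] [InnerProductSpace ℂ H] [CompleteSpace H]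

/-- The span of the eigenvectors of `|x|` for eigenvalues greater than `t`. Eigenspaces for
different eigenvalues are independent, so its dimension is the number of eigenvalues of `|x|`
greater than `t`, counted with multiplicity. -/
def eigenspanAbove (x : H →L[ℂ] H) (t : ℝ) : Submodule ℂ H :=
  ⨆ (μ : ℝ) (_ : t < μ), Module.End.eigenspace ((CFC.abs x : H →L[ℂ] H) : H →ₗ[ℂ] H) (μ : ℂ)

/-- The singular values of a compact operator `x`: the eigenvalues of `|x| = (x⋆ x)^{1/2}` in
decreasing order, repeated according to multiplicity (followed by zeros when `x` has finite
rank). The `n`-th one, counted from `0`, is the infimum of the levels `t ≥ 0` that are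
exceeded by at most `n` eigenvalues of `|x|`, counted with multiplicity. -/
def singularValue (x : H →L[ℂ] H) (n : ℕ) : ℝ :=
  sInf {t : ℝ | 0 ≤ t ∧ Module.rank ℂ (eigenspanAbove x t) ≤ n}

/-- A symmetric quasi-Banach ideal of compact operators: a nonzero two-sided ideal `I` of the
algebra of bounded operators, consisting of compact operators, with a complete symmetric
quasi-norm, which takes the value `1` at one-dimensional (orthogonal) projections. -/
structure IsSymmetricQuasiBanachIdeal (I : Submodule ℂ (H →L[ℂ] H)) (q : I → ℝ) : Prop where
  mul_mem : ∀ (a b : H →L[ℂ] H), ∀ x ∈ I, a * x * b ∈ I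
  ne_bot : I ≠ ⊥
  compact : ∀ x ∈ I, IsCompactOperator x
  quasiNorm : IsQuasiNorm ℂ q
  complete : IsCompleteQuasiNorm q
  symmetric : ∀ (a b : H →L[ℂ] H) (x : I),
    q ⟨a * x * b, mul_mem a b x x.2⟩ ≤ ‖a‖ * q x * ‖b‖
  normalized : ∀ p : I, IsStarProjection (p : H →L[ℂ] H) →
    Module.finrank ℂ (p : H →L[ℂ] H).range = 1 → q p = 1

/-! ## The Calkin correspondence -/

/-- The set `E_I` of null sequences `ξ` such that `ξ* = s(x)` for some `x ∈ I`. -/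
def calkinSequences (I : Submodule ℂ (H →L[ℂ] H)) : Set (ℕ → ℝ) :=
  {ξ | Tendsto ξ atTop (𝓝 0) ∧ ∃ x ∈ I, decrRearrangement ξ = singularValue x}

variable (H) in
/-- The set `C_E` of compact operators whose sequence of singular values belongs to `E`. -/
def calkinOperators (E : Submodule ℝ (ℕ → ℝ)) : Set (H →L[ℂ] H) :=
  {x | IsCompactOperator x ∧ singularValue x ∈ E}

/-- The function `‖x‖ = ‖s(x)‖_E` on `C_E`. -/
def calkinOperatorsNorm (E : Submodule ℝ (ℕ → ℝ)) (N : E → ℝ) (x : calkinOperators H E) : ℝ :=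
  N ⟨singularValue (x : H →L[ℂ] H), x.2.2⟩

end

/-! ## Decreasing rearrangements -/

/-! Fix an orthonormal sequence `e` and write `D_ξ` for the diagonal operator along `e` with
diagonal `ξ`. The Schmidt decomposition gives, for each compact `x`, a null sequence `ξ` with `ξ* =
s(x)` such that `x` and `D_ξ` arise from each other by multiplication with contractions
(`IsCompactOperator.exists_diagonal`). Hence they lie in the same symmetric ideals, with equal
quasi-norms. If `ξ* ≤ η*`, matching the terms injectively writes `D_ξ` as `a * D_η * b` with
contractions `a`, `b` (`IsSchmidt.exists_eq_mul_mul`).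

So `E_I` is the set of `ξ` with `D_ξ ∈ I`, and its norm is `q (D_ξ)`. As `ξ ↦ D_ξ` is linear, the
vector space structure and the quasi-triangle inequality, with the same constant, are inherited from
`I` without any inequality for singular values of sums. Completeness is inherited too, because `q`
dominates the operator norm and diagonal operators are closed under operator norm limits. -/

theorem decrRearrangement_nonneg (ξ : ℕ → ℝ) (n : ℕ) : 0 ≤ decrRearrangement ξ n :=
  Real.sInf_nonneg fun _ ht => ht.1

theorem decrRearrangement_le {ξ : ℕ → ℝ} {n : ℕ} {t : ℝ} (ht : 0 ≤ t)
    (h : {k : ℕ | t < |ξ k|}.encard ≤ n) : decrRearrangement ξ n ≤ t :=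
  csInf_le ⟨0, fun _ hs => hs.1⟩ ⟨ht, h⟩

/-- The infimum is attained: among `n + 1` indices above `t`, the smallest `|ξ k|` exceeds `t` and
is a lower bound for all admissible levels. Boundedness makes the set of levels nonempty, which
excludes the default `sInf ∅ = 0`. -/
theorem encard_le_of_decrRearrangement_le {ξ : ℕ → ℝ} (hξ : ∃ M, ∀ k, |ξ k| ≤ M) {n : ℕ} {t : ℝ}
    (h : decrRearrangement ξ n ≤ t) : {k : ℕ | t < |ξ k|}.encard ≤ n := by
  by_contra! hn
  obtain ⟨F, hF, hFn⟩ := Set.exists_subset_encard_eq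
    (show ((n + 1 : ℕ) : ℕ∞) ≤ _ by exact_mod_cast Order.add_one_le_of_lt hn)
  have hfin : F.Finite := Set.finite_of_encard_eq_coe hFn
  have hne : F.Nonempty := by
    rw [← Set.encard_pos, hFn]; exact_mod_cast Nat.succ_pos n
  obtain ⟨k₀, hk₀, hmin⟩ := hfin.exists_minimalFor (fun k => |ξ k|) F hne
  have hle : ∀ k ∈ F, |ξ k₀| ≤ |ξ k| := fun k hk => by
    rcases le_total |ξ k₀| |ξ k| with h1 | h1
    · exact h1
    · exact hmin hk h1
  obtain ⟨M, hM⟩ := hξ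
  have : |ξ k₀| ≤ decrRearrangement ξ n := by
    refine le_csInf ⟨M, (abs_nonneg _).trans (hM 0), ?_⟩ ?_
    · simp [not_lt.2 (hM _)]
    · rintro s ⟨-, hs⟩
      by_contra! hlt
      have : F ⊆ {k | s < |ξ k|} := fun k hk => hlt.trans_le (hle k hk)
      have := (Set.encard_le_encard this).trans hs
      rw [hFn] at this
      have : n + 1 ≤ n := by exact_mod_cast this
      omega
  exact absurd (hF hk₀) (not_lt.2 (this.trans h))

theorem exists_abs_le_of_tendsto {ξ : ℕ → ℝ} (h : Tendsto ξ atTop (𝓝 0)) :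
    ∃ M, ∀ k, |ξ k| ≤ M := by
  obtain ⟨M, hM⟩ := h.abs.bddAbove_range
  exact ⟨M, fun k => hM ⟨k, rfl⟩⟩

theorem tendsto_zero_iff_finite {ξ : ℕ → ℝ} :
    Tendsto ξ atTop (𝓝 0) ↔ ∀ t > 0, {k | t < |ξ k|}.Finite := by
  rw [Metric.tendsto_nhds, ← Nat.cofinite_eq_atTop]
  simp only [eventually_cofinite, dist_zero_right, Real.norm_eq_abs, not_lt]
  refine ⟨fun h t ht => (h t ht).subset fun k (hk : t < |ξ k|) => hk.le, fun h t ht => ?_⟩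
  exact (h (t / 2) (half_pos ht)).subset fun k hk => (half_lt_self ht).trans_le hk

theorem decrRearrangement_antitone {ξ : ℕ → ℝ} (hξ : ∃ M, ∀ k, |ξ k| ≤ M) :
    Antitone (decrRearrangement ξ) := by
  intro m n hmn
  exact decrRearrangement_le (decrRearrangement_nonneg _ _)
    ((encard_le_of_decrRearrangement_le hξ le_rfl).trans (by exact_mod_cast hmn))

theorem tendsto_decrRearrangement {ξ : ℕ → ℝ} (h : Tendsto ξ atTop (𝓝 0)) :
    Tendsto (decrRearrangement ξ) atTop (𝓝 0) := by
  rw [Metric.tendsto_atTop]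
  intro ε hε
  have hf := tendsto_zero_iff_finite.1 h (ε / 2) (half_pos hε)
  refine ⟨hf.toFinset.card, fun n hn => ?_⟩
  have : decrRearrangement ξ n ≤ ε / 2 := by
    refine decrRearrangement_le (half_pos hε).le ?_
    rw [hf.encard_eq_coe_toFinset_card]
    exact_mod_cast hn
  rw [dist_zero_right, Real.norm_of_nonneg (decrRearrangement_nonneg _ _)]
  linarith

theorem decrRearrangement_of_antitone {s : ℕ → ℝ} (h0 : ∀ n, 0 ≤ s n) (hs : Antitone s) :
    decrRearrangement s = s := by
  funext n
  apply le_antisymm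
  · refine decrRearrangement_le (h0 n) ?_
    have : {k | s n < |s k|} ⊆ (Finset.range n : Set ℕ) := by
      intro k hk
      rw [Set.mem_ofPred_eq, abs_of_nonneg (h0 k)] at hk
      simp only [Finset.coe_range, Set.mem_Iio]
      by_contra! hnk
      exact absurd (hs hnk) (not_le.2 hk)
    refine (Set.encard_le_encard this).trans ?_
    rw [Set.encard_coe_eq_coe_finsetCard, Finset.card_range]
  · have hb : ∃ M, ∀ k, |s k| ≤ M := ⟨s 0, fun k => by
      rw [abs_of_nonneg (h0 k)]; exact hs (Nat.zero_le k)⟩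
    by_contra! hlt
    have h1 := encard_le_of_decrRearrangement_le hb (le_refl (decrRearrangement s n))
    have : (Finset.range (n + 1) : Set ℕ) ⊆ {k | decrRearrangement s n < |s k|} := by
      intro k hk
      simp only [Finset.coe_range, Set.mem_Iio] at hk
      rw [Set.mem_ofPred_eq, abs_of_nonneg (h0 k)]
      exact hlt.trans_le (hs (by omega))
    have := (Set.encard_le_encard this).trans h1
    rw [Set.encard_coe_eq_coe_finsetCard, Finset.card_range] at this
    have : n + 1 ≤ n := by exact_mod_cast this
    omega

theorem decrRearrangement_decrRearrangement {ξ : ℕ → ℝ} (hξ : ∃ M, ∀ k, |ξ k| ≤ M) :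
    decrRearrangement (decrRearrangement ξ) = decrRearrangement ξ :=
  decrRearrangement_of_antitone (decrRearrangement_nonneg ξ) (decrRearrangement_antitone hξ)

theorem tendsto_of_decrRearrangement_le {ξ η : ℕ → ℝ} (hξ : ∃ M, ∀ k, |ξ k| ≤ M)
    (hη : Tendsto η atTop (𝓝 0)) (h : decrRearrangement ξ ≤ decrRearrangement η) :
    Tendsto ξ atTop (𝓝 0) := by
  refine tendsto_zero_iff_finite.2 fun t ht => ?_
  have hf := tendsto_zero_iff_finite.1 hη t ht
  have h1 : decrRearrangement η hf.toFinset.card ≤ t :=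
    decrRearrangement_le ht.le (by rw [hf.encard_eq_coe_toFinset_card])
  exact Set.finite_of_encard_le_coe (encard_le_of_decrRearrangement_le hξ ((h _).trans h1))

/-- By Hall's theorem, a null sequence whose rearrangement is dominated by that of another null
sequence can be matched injectively with larger terms of the latter. -/
theorem exists_injective_abs_le {ξ η : ℕ → ℝ} (hξ : Tendsto ξ atTop (𝓝 0))
    (hη : Tendsto η atTop (𝓝 0)) (h : decrRearrangement ξ ≤ decrRearrangement η) :
    ∃ σ : {k // ξ k ≠ 0} → ℕ, Function.Injective σ ∧ ∀ k : {k // ξ k ≠ 0}, |ξ k| ≤ |η (σ k)| := by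
  have hfin : ∀ a : ℝ, 0 < a → {m | a ≤ |η m|}.Finite := fun a ha =>
    (tendsto_zero_iff_finite.1 hη (a / 2) (half_pos ha)).subset
      fun k hk => (half_lt_self ha).trans_le hk
  have hpos : ∀ k : {k // ξ k ≠ 0}, 0 < |ξ k| := fun k => abs_pos.2 k.2
  obtain ⟨σ, hσ, hσ'⟩ := (Finset.all_card_le_biUnion_card_iff_exists_injective
    (fun k : {k // ξ k ≠ 0} => (hfin _ (hpos k)).toFinset)).1 (by
      intro s
      rcases s.eq_empty_or_nonempty with rfl | hs
      · simp
      -- Hall's condition: the target sets are nested, so the one of the smallest `|ξ k|` must hold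
      -- all of `s`.
      obtain ⟨k₀, hk₀, hmin⟩ := s.exists_min_image (fun k => |ξ k|) hs
      refine le_trans ?_ (Finset.card_le_card (Finset.subset_biUnion_of_mem _ hk₀))
      set a := |ξ k₀| with ha
      set N := (hfin _ (hpos k₀)).toFinset.card with hN
      have hapos : 0 < a := hpos k₀
      -- Rearrangements count strict inequalities, whereas the matching needs `a ≤ |η m|`. Since `η`
      -- is null, only finitely many of its terms lie in `[a/2, a)`, which leaves a gap just below
      -- `a`.
      obtain ⟨b, hb0, hba, hb⟩ : ∃ b, 0 < b ∧ b < a ∧ ∀ m, b < |η m| → a ≤ |η m| := by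
        have hB : {m | a / 2 ≤ |η m| ∧ |η m| < a}.Finite :=
          (hfin (a / 2) (half_pos hapos)).subset fun m hm => hm.1
        have h1 : ∀ᶠ b in 𝓝[<] a, ∀ m ∈ {m | a / 2 ≤ |η m| ∧ |η m| < a}, |η m| < b := by
          rw [eventually_all_finite hB]
          intro m hm
          exact mem_nhdsWithin_of_mem_nhds (lt_mem_nhds hm.2)
        have h2 : ∀ᶠ b in 𝓝[<] a, a / 2 < b :=
          mem_nhdsWithin_of_mem_nhds (lt_mem_nhds (half_lt_self hapos))
        obtain ⟨b, ⟨hb1, hb2⟩, hb3⟩ := ((h1.and h2).and self_mem_nhdsWithin).exists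
        refine ⟨b, by linarith, hb3, fun m hm => ?_⟩
        by_contra! hlt
        exact absurd (hb1 m ⟨by linarith, hlt⟩) (not_lt.2 hm.le)
      have h1 : decrRearrangement η N ≤ b := by
        refine decrRearrangement_le hb0.le ?_
        refine (Set.encard_le_encard (show _ ⊆ {m | a ≤ |η m|} from hb)).trans ?_
        rw [(hfin _ (hpos k₀)).encard_eq_coe_toFinset_card]
      have h2 := encard_le_of_decrRearrangement_le (exists_abs_le_of_tendsto hξ) ((h N).trans h1)
      have h3 : ((s.map (Function.Embedding.subtype _) : Finset ℕ) : Set ℕ) ⊆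
          {k | b < |ξ k|} := by
        intro k hk
        simp only [Finset.coe_map, Set.mem_image] at hk
        obtain ⟨k', hk', rfl⟩ := hk
        exact hba.trans_le (hmin k' hk')
      have h4 := (Set.encard_le_encard h3).trans h2
      rw [Set.encard_coe_eq_coe_finsetCard, Finset.card_map] at h4
      exact_mod_cast h4)
  exact ⟨σ, hσ, fun k => (hfin _ (hpos k)).mem_toFinset.1 (hσ' k)⟩

section

variable {H : Type*} [NormedAddCommGroup H] [InnerProductSpace ℂ H]
open scoped InnerProductSpace

/-! ## Operators with a Schmidt decomposition -/

/-- The operator `A` maps `v i` to `c i • u i` and vanishes on the orthogonal complement of the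
family `v`; for orthonormal `u`, `v` this says that `A = ∑ c i ⟪v i, ·⟫ u i`. -/
structure IsSchmidt {ι : Type*} (u v : ι → H) (c : ι → ℂ) (A : H →L[ℂ] H) : Prop where
  apply : ∀ i, A (v i) = c i • u i
  apply_eq_zero : ∀ y, (∀ i, ⟪v i, y⟫_ℂ = 0) → A y = 0

namespace IsSchmidt

variable {ι : Type*} {u v w : ι → H} {c d : ι → ℂ} {A B : H →L[ℂ] H}

theorem add (hA : IsSchmidt u v c A) (hB : IsSchmidt u v d B) :
    IsSchmidt u v (c + d) (A + B) where
  apply i := by simp [hA.apply, hB.apply, add_smul]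
  apply_eq_zero y hy := by simp [hA.apply_eq_zero y hy, hB.apply_eq_zero y hy]

theorem smul (a : ℂ) (hA : IsSchmidt u v c A) : IsSchmidt u v (a • c) (a • A) where
  apply i := by simp [hA.apply, mul_smul]
  apply_eq_zero y hy := by simp [hA.apply_eq_zero y hy]

theorem mul (hA : ∀ i, A (v i) = c i • u i) (hB : IsSchmidt v w d B) :
    IsSchmidt u w (c * d) (A * B) where
  apply i := by
    simp only [mul_apply_eq_comp, hB.apply, map_smul, hA, Pi.mul_apply, smul_smul]
    rw [mul_comm]
  apply_eq_zero y hy := by simp [hB.apply_eq_zero y hy]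

variable [CompleteSpace H]

/-- The kernel contains every `v i`, so its orthogonal complement is orthogonal to the family and
lies in the kernel as well. A closed subspace containing its complement is everything. -/
theorem _root_.ContinuousLinearMap.eq_zero_of_forall_orthogonal {F : Type*} [NormedAddCommGroup F]
    [NormedSpace ℂ F] {A : H →L[ℂ] F} (h : ∀ i, A (v i) = 0)
    (h' : ∀ y, (∀ i, ⟪v i, y⟫_ℂ = 0) → A y = 0) (y : H) : A y = 0 := by
  have hc : IsClosed (A.ker : Set H) := A.isClosed_ker
  have : CompleteSpace A.ker := hc.completeSpace_coe
  have hle : A.kerᗮ ≤ A.ker := fun z hz => h' z fun i => hz (v i) (h i)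
  have htop : A.ker = ⊤ := by
    rw [← Submodule.sup_orthogonal_of_hasOrthogonalProjection (K := A.ker)]
    exact (sup_eq_left.2 hle).symm
  have : y ∈ A.ker := htop ▸ Submodule.mem_top
  exact this

theorem ext (hA : IsSchmidt u v c A) (hB : IsSchmidt u v c B) : A = B := by
  ext y
  rw [← sub_eq_zero, ← sub_apply]
  refine ContinuousLinearMap.eq_zero_of_forall_orthogonal (v := v) (fun i => ?_) (fun y hy => ?_) y
  · simp [hA.apply, hB.apply]
  · simp [hA.apply_eq_zero y hy, hB.apply_eq_zero y hy]

theorem inner_apply (hu : Orthonormal ℂ u) (hv : Orthonormal ℂ v) (hA : IsSchmidt u v c A)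
    (i : ι) (y : H) : ⟪u i, A y⟫_ℂ = c i * ⟪v i, y⟫_ℂ := by
  classical
  have := ContinuousLinearMap.eq_zero_of_forall_orthogonal (v := v)
    (A := innerSL ℂ (u i) ∘L A - c i • innerSL ℂ (v i)) (fun j => ?_) (fun y hy => ?_) y
  · simpa [sub_eq_zero] using this
  · rcases eq_or_ne i j with rfl | hij
    · simp [hA.apply, hu.1, hv.1]
    · simp [hA.apply, orthonormal_iff_ite.1 hu, orthonormal_iff_ite.1 hv, hij]
  · simp [hA.apply_eq_zero y hy, hy]

theorem adjoint (hu : Orthonormal ℂ u) (hv : Orthonormal ℂ v) (hA : IsSchmidt u v c A) :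
    IsSchmidt v u (star c) (star A) where
  apply i := by
    refine ext_inner_right ℂ fun y => ?_
    rw [ContinuousLinearMap.star_eq_adjoint, ContinuousLinearMap.adjoint_inner_left,
      hA.inner_apply hu hv, inner_smul_left]
    simp
  apply_eq_zero y hy := by
    refine ext_inner_right ℂ fun z => ?_
    rw [ContinuousLinearMap.star_eq_adjoint, ContinuousLinearMap.adjoint_inner_left,
      inner_zero_left]
    refine ContinuousLinearMap.eq_zero_of_forall_orthogonal (v := v)
      (A := innerSL ℂ y ∘L A) (fun j => ?_) (fun z hz => ?_) z
    · have : ⟪y, u j⟫_ℂ = 0 := inner_eq_zero_symm.1 (hy j)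
      simp [hA.apply, this]
    · simp [hA.apply_eq_zero z hz]

/-- The operator is `y ↦ ∑ c i ⟪v i, y⟫ u i`; orthogonality of the `u i` and Bessel's inequality for
`v` give convergence and the bound. With `c = 1` this supplies the partial isometries used below. -/
theorem exists_norm_le (hu : Orthonormal ℂ u) (hv : Orthonormal ℂ v) {M : ℝ} (hM : 0 ≤ M)
    (hc : ∀ i, ‖c i‖ ≤ M) : ∃ A : H →L[ℂ] H, ‖A‖ ≤ M ∧ IsSchmidt u v c A := by
  classical
  have hterm : ∀ y i, ‖c i * ⟪v i, y⟫_ℂ‖ ^ 2 ≤ M ^ 2 * ‖⟪v i, y⟫_ℂ‖ ^ 2 := fun y i => by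
    rw [norm_mul, mul_pow]
    gcongr
    exact hc i
  have hs : ∀ y, Summable fun i => (c i * ⟪v i, y⟫_ℂ) • u i := fun y => by
    have h := (hu.orthogonalFamily.summable_iff_norm_sq_summable
      (fun i => c i * ⟪v i, y⟫_ℂ)).2 ?_
    · simpa using h
    · exact Summable.of_nonneg_of_le (fun i => by positivity) (hterm y)
        ((hv.inner_products_summable y).mul_left _)
  have hn : ∀ y, ‖∑' i, (c i * ⟪v i, y⟫_ℂ) • u i‖ ≤ M * ‖y‖ := fun y => by
    refine le_of_tendsto (hs y).hasSum.norm (Eventually.of_forall fun F => ?_)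
    refine abs_le_of_sq_le_sq' ?_ (by positivity) |>.2
    have h := hu.orthogonalFamily.norm_sum (fun i => c i * ⟪v i, y⟫_ℂ) F
    simp only [LinearIsometry.toSpanSingleton_apply] at h
    rw [h, mul_pow]
    calc ∑ i ∈ F, ‖c i * ⟪v i, y⟫_ℂ‖ ^ 2 ≤ ∑ i ∈ F, M ^ 2 * ‖⟪v i, y⟫_ℂ‖ ^ 2 :=
          Finset.sum_le_sum fun i _ => hterm y i
      _ = M ^ 2 * ∑ i ∈ F, ‖⟪v i, y⟫_ℂ‖ ^ 2 := by rw [Finset.mul_sum]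
      _ ≤ M ^ 2 * ‖y‖ ^ 2 := by gcongr; exact hv.sum_inner_products_le y
  let L : H →ₗ[ℂ] H :=
    { toFun := fun y => ∑' i, (c i * ⟪v i, y⟫_ℂ) • u i
      map_add' := fun y z => by
        rw [← (hs y).tsum_add (hs z)]
        simp only [inner_add_right, mul_add, add_smul]
      map_smul' := fun a y => by
        simp only [inner_smul_right, RingHom.id_apply]
        rw [← (hs y).tsum_const_smul a]
        simp only [smul_smul]
        congr 1
        ext i
        ring_nf }
  refine ⟨L.mkContinuous M hn, L.mkContinuous_norm_le hM hn, fun i => ?_, fun y hy => ?_⟩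
  · change ∑' j, (c j * ⟪v j, v i⟫_ℂ) • u j = c i • u i
    rw [tsum_eq_single i]
    · simp [hv.1]
    · intro j hj
      simp [orthonormal_iff_ite.1 hv, hj]
  · change ∑' j, (c j * ⟪v j, y⟫_ℂ) • u j = 0
    simp [hy]

end IsSchmidt

end

section

open scoped InnerProductSpace
variable {H : Type*} [NormedAddCommGroup H] [InnerProductSpace ℂ H] [CompleteSpace H]

/-! ## Singular values of operators with a Schmidt decomposition -/

/-- With `R = |x|` and `R² v = μ² v`, the vector `w = R v - μ v` satisfies `R w = -μ w`, and
positivity of `R` forces `w = 0`. -/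
theorem cfcAbs_apply_eq_iff (x : H →L[ℂ] H) {μ : ℝ} (hμ : 0 < μ) (v : H) :
    (CFC.abs x : H →L[ℂ] H) v = (μ : ℂ) • v ↔ (star x * x) v = ((μ : ℂ) ^ 2) • v := by
  set R : H →L[ℂ] H := CFC.abs x with hR
  have hpos : R.IsPositive := (ContinuousLinearMap.nonneg_iff_isPositive R).1 (CFC.abs_nonneg x)
  rw [← CFC.abs_mul_abs x, ← hR, mul_apply_eq_comp]
  constructor
  · intro h
    rw [h, map_smul, h, smul_smul, sq]
  · intro h
    set w := R v - (μ : ℂ) • v with hw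
    have h1 : R w + (μ : ℂ) • w = 0 := by
      rw [hw, map_sub, h, map_smul, smul_sub, smul_smul, sq]
      abel
    have h2 : ⟪w, R w⟫_ℂ + (μ : ℂ) * ⟪w, w⟫_ℂ = 0 := by
      rw [← inner_smul_right, ← inner_add_right, h1, inner_zero_right]
    have h3 := congrArg Complex.re h2
    have h4 : 0 ≤ (⟪w, R w⟫_ℂ).re := hpos.re_inner_nonneg_right w
    rw [inner_self_eq_norm_sq_to_K] at h3
    have h5 : (⟪w, R w⟫_ℂ).re + μ * ‖w‖ ^ 2 = 0 := by
      have : ((μ : ℂ) * ((‖w‖ : ℝ) : ℂ) ^ 2).re = μ * ‖w‖ ^ 2 := by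
        rw [← Complex.ofReal_pow, ← Complex.ofReal_mul, Complex.ofReal_re]
      rw [Complex.add_re] at h3
      rw [← this]
      exact h3
    have h6 : ‖w‖ ^ 2 = 0 := by
      have : 0 ≤ μ * ‖w‖ ^ 2 := by positivity
      have : μ * ‖w‖ ^ 2 = 0 := by linarith
      exact (mul_eq_zero.1 this).resolve_left hμ.ne'
    have h7 : w = 0 := by simpa using h6
    rwa [hw, sub_eq_zero] at h7

namespace IsSchmidt

variable {ι : Type*} {u v : ι → H} {c : ι → ℂ} {x : H →L[ℂ] H}

theorem star_mul_self_apply (hu : Orthonormal ℂ u) (hv : Orthonormal ℂ v)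
    (hx : IsSchmidt u v c x) (i : ι) : (star x * x) (v i) = ((‖c i‖ : ℂ) ^ 2) • v i := by
  rw [mul_apply_eq_comp, hx.apply, map_smul, (hx.adjoint hu hv).apply, smul_smul]
  congr 1
  simpa using Complex.mul_conj' (c i)

theorem eigenspanAbove_eq (hu : Orthonormal ℂ u) (hv : Orthonormal ℂ v)
    (hx : IsSchmidt u v c x) (hc : ∀ t > 0, {i | t < ‖c i‖}.Finite) {t : ℝ} (ht : 0 ≤ t) :
    eigenspanAbove x t = Submodule.span ℂ (v '' {i | t < ‖c i‖}) := by
  classical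
  apply le_antisymm
  · refine iSup₂_le fun μ hμ y hy => ?_
    have hμ0 : 0 < μ := ht.trans_lt hμ
    rw [Module.End.mem_eigenspace_iff] at hy
    have hy' : (star x * x) y = ((μ : ℂ) ^ 2) • y := (cfcAbs_apply_eq_iff x hμ0 y).1 hy
    have hfin : {i | ‖c i‖ = μ}.Finite := (hc (μ / 2) (half_pos hμ0)).subset
      fun i (hi : ‖c i‖ = μ) => by
        rw [Set.mem_ofPred_eq, hi]; exact half_lt_self hμ0
    set F := hfin.toFinset with hF
    have hFi : ∀ i, i ∈ F ↔ ‖c i‖ = μ := fun i => by simp [hF]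
    -- The part of the eigenvector `y` outside the span of the `v i` with `‖c i‖ = μ` is orthogonal
    -- to every `v i`, so `x` kills it; since `x⋆ x` also multiplies it by `μ² ≠ 0`, it vanishes.
    set z := y - ∑ i ∈ F, ⟪v i, y⟫_ℂ • v i with hz
    have hTz : (star x * x) z = ((μ : ℂ) ^ 2) • z := by
      rw [hz, map_sub, hy', smul_sub, map_sum, Finset.smul_sum]
      congr 1
      refine Finset.sum_congr rfl fun i hi => ?_
      rw [map_smul, hx.star_mul_self_apply hu hv, (hFi i).1 hi, smul_comm]
    have horth : ∀ i, ⟪v i, z⟫_ℂ = 0 := by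
      intro i
      by_cases hi : i ∈ F
      · rw [hz, inner_sub_right, hv.inner_right_sum _ hi, sub_self]
      · have h1 : ⟪v i, (star x * x) z⟫_ℂ = ⟪(star x * x) (v i), z⟫_ℂ := by
          rw [← ContinuousLinearMap.adjoint_inner_left, ← ContinuousLinearMap.star_eq_adjoint,
            star_mul, star_star]
        rw [hTz, hx.star_mul_self_apply hu hv, inner_smul_right, inner_smul_left, ← sub_eq_zero,
          ← sub_mul] at h1
        refine (mul_eq_zero.1 h1).resolve_left fun h2 => hi ((hFi i).2 ?_)
        rw [map_pow, Complex.conj_ofReal, sub_eq_zero, ← Complex.ofReal_pow, ← Complex.ofReal_pow,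
          Complex.ofReal_inj, sq_eq_sq₀ hμ0.le (norm_nonneg _)] at h2
        exact h2.symm
    have hz0 : z = 0 := by
      rw [mul_apply_eq_comp, hx.apply_eq_zero z horth, map_zero] at hTz
      refine (smul_eq_zero.1 hTz.symm).resolve_left ?_
      exact pow_ne_zero 2 (Complex.ofReal_ne_zero.2 hμ0.ne')
    rw [hz, sub_eq_zero] at hz0
    rw [hz0]
    refine Submodule.sum_mem _ fun i hi => Submodule.smul_mem _ _ (Submodule.subset_span ⟨i, ?_, rfl⟩)
    rw [Set.mem_ofPred_eq, (hFi i).1 hi]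
    exact hμ
  · rw [Submodule.span_le]
    rintro _ ⟨i, hi, rfl⟩
    refine Submodule.mem_iSup_of_mem ‖c i‖ (Submodule.mem_iSup_of_mem hi ?_)
    rw [Module.End.mem_eigenspace_iff]
    exact (cfcAbs_apply_eq_iff x (ht.trans_lt hi) (v i)).2 (hx.star_mul_self_apply hu hv i)

theorem singularValue_eq (hu : Orthonormal ℂ u) (hv : Orthonormal ℂ v)
    (hx : IsSchmidt u v c x) (hc : ∀ t > 0, {i | t < ‖c i‖}.Finite) (n : ℕ) :
    singularValue x n = sInf {t : ℝ | 0 ≤ t ∧ {i | t < ‖c i‖}.encard ≤ n} := by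
  unfold singularValue
  congr 1
  ext t
  refine and_congr_right fun ht => ?_
  have hli : LinearIndepOn ℂ id (v '' {i | t < ‖c i‖}) :=
    (hv.linearIndependent.linearIndepOn_id).mono (Set.image_subset_range _ _)
  rw [hx.eigenspanAbove_eq hu hv hc ht, rank_span_set hli,
    ← hv.linearIndependent.injective.encard_image, Set.encard, ENat.card, Cardinal.toENat_le_natCast]

end IsSchmidt

end

section

open scoped InnerProductSpace
variable {H : Type*} [NormedAddCommGroup H] [InnerProductSpace ℂ H] [CompleteSpace H]

/-! ## The Schmidt decomposition of compact operators -/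

/-- Infinitely many such `i` would give images `x (v i)` of unit vectors at mutual distance greater
than `t`, since pairing `x (v i) - x (v j)` with `u i` returns `c i`. No subsequence could converge.
-/
theorem IsSchmidt.finite_of_isCompactOperator {ι : Type*} {u v : ι → H} {c : ι → ℂ}
    {x : H →L[ℂ] H} (hu : Orthonormal ℂ u) (hv : Orthonormal ℂ v)
    (hx : IsSchmidt u v c x) (hxc : IsCompactOperator x) {t : ℝ} (ht : 0 < t) :
    {i | t < ‖c i‖}.Finite := by
  classical
  by_contra hinf
  let φ := Set.Infinite.natEmbedding _ hinf
  obtain ⟨K, hK, hsub⟩ := hxc.image_closedBall_subset_compact (𝕜₁ := ℂ) (f := (x : H →ₗ[ℂ] H)) 1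
  have hmem : ∀ n, x (v (φ n).1) ∈ K := fun n => hsub ⟨v (φ n).1, by simp [hv.1], rfl⟩
  obtain ⟨a, -, ψ, hψ, hlim⟩ := hK.tendsto_subseq hmem
  obtain ⟨N, hN⟩ := Metric.cauchySeq_iff.1 hlim.cauchySeq t ht
  have h1 := hN N le_rfl (N + 1) (Nat.le_succ N)
  set i : ι := (φ (ψ N)).1
  set j : ι := (φ (ψ (N + 1))).1
  have hij : i ≠ j := fun h => by
    have := hψ.injective (φ.injective (Subtype.ext h))
    omega
  have h2 : ⟪u i, x (v i) - x (v j)⟫_ℂ = c i := by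
    rw [inner_sub_right, hx.inner_apply hu hv, hx.inner_apply hu hv, orthonormal_iff_ite.1 hv,
      orthonormal_iff_ite.1 hv]
    simp [hij]
  have h3 : ‖c i‖ ≤ ‖x (v i) - x (v j)‖ := by
    rw [← h2]
    exact (norm_inner_le_norm _ _).trans_eq (by rw [hu.1, one_mul])
  have h4 : t < ‖c i‖ := (φ (ψ N)).2
  rw [dist_eq_norm] at h1
  exact absurd (h4.trans_le h3) (not_lt.2 h1.le)

/-- Spectral theorem for `T = x⋆ x`: `v` collects orthonormal bases of the eigenspaces for nonzero
eigenvalues, `c` the norms `‖x (v a)‖`, and `u` the normalized images. -/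
theorem IsCompactOperator.exists_isSchmidt {x : H →L[ℂ] H} (hx : IsCompactOperator x) :
    ∃ (ι : Type) (u v : ι → H) (c : ι → ℝ), Orthonormal ℂ u ∧ Orthonormal ℂ v ∧
      (∀ i, 0 < c i) ∧ IsSchmidt u v (fun i => (c i : ℂ)) x := by
  classical
  set T : H →L[ℂ] H := star x * x with hT
  have hTc : IsCompactOperator T := hx.clm_comp (star x)
  have hTsa : IsSelfAdjoint T := IsSelfAdjoint.star_mul_self x
  have hTs : (T : H →ₗ[ℂ] H).IsSymmetric := hTsa.isSymmetric
  have hinner : ∀ y z, ⟪x y, x z⟫_ℂ = ⟪y, T z⟫_ℂ := fun y z => by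
    rw [hT, mul_apply_eq_comp, ContinuousLinearMap.star_eq_adjoint,
      ContinuousLinearMap.adjoint_inner_right]
  let Ev : ℂ → Submodule ℂ H := fun μ => Module.End.eigenspace (T : H →ₗ[ℂ] H) μ
  have hfd : ∀ μ : {μ : ℂ // μ ≠ 0}, FiniteDimensional ℂ (Ev μ) := fun μ =>
    ContinuousLinearMap.finite_dimensional_eigenspace hTc μ μ.2
  let b : ∀ μ : {μ : ℂ // μ ≠ 0}, OrthonormalBasis (Fin (Module.finrank ℂ (Ev μ))) ℂ (Ev μ) :=
    fun μ => stdOrthonormalBasis ℂ (Ev μ)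
  let v : (Σ μ : {μ : ℂ // μ ≠ 0}, Fin (Module.finrank ℂ (Ev μ))) → H := fun a => b a.1 a.2
  have hv : Orthonormal ℂ v :=
    (hTs.orthogonalFamily_eigenspaces.comp Subtype.val_injective).orthonormal_sigma_orthonormal
      (v_family := fun μ => b μ) fun μ => (b μ).orthonormal
  have hTv : ∀ a, T (v a) = (a.1 : ℂ) • v a := fun a =>
    Module.End.mem_eigenspace_iff.1 (b a.1 a.2).2
  have hin : ∀ a a', ⟪x (v a), x (v a')⟫_ℂ = (a'.1 : ℂ) * if a = a' then 1 else 0 := fun a a' => by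
    rw [hinner, hTv, inner_smul_right, orthonormal_iff_ite.1 hv]
  have hnorm : ∀ a, (a.1 : ℂ) = (‖x (v a)‖ : ℂ) ^ 2 := fun a => by
    have := hin a a
    rw [inner_self_eq_norm_sq_to_K, if_pos rfl, mul_one] at this
    exact this.symm
  have hpos : ∀ a, 0 < ‖x (v a)‖ := fun a => by
    rw [norm_pos_iff]
    intro h
    have := hnorm a
    rw [h] at this
    exact a.1.2 (by simpa using this)
  have hne : ∀ a, (‖x (v a)‖ : ℂ) ≠ 0 := fun a => Complex.ofReal_ne_zero.2 (hpos a).ne'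
  refine ⟨_, fun a => ((‖x (v a)‖ : ℂ)⁻¹) • x (v a), v, fun a => ‖x (v a)‖, ?_, hv, hpos, ?_, ?_⟩
  · rw [orthonormal_iff_ite]
    intro a a'
    rw [inner_smul_left, inner_smul_right, hin, hnorm a']
    split_ifs with h
    · subst h
      rw [map_inv₀, Complex.conj_ofReal]
      field_simp [hne a]
    · simp
  · intro a
    rw [smul_smul, mul_inv_cancel₀ (hne a), one_smul]
  · intro y hy
    -- Testing `T y` rather than `y` makes the eigenvalue `0` harmless.
    have hperp : ∀ μ : ℂ, ∀ z ∈ Ev μ, ⟪z, T y⟫_ℂ = 0 := fun μ z hz => by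
      have hz' : T z = μ • z := Module.End.mem_eigenspace_iff.1 hz
      have h1 : ⟪z, T y⟫_ℂ = ⟪T z, y⟫_ℂ := (hTs z y).symm
      rw [h1, hz', inner_smul_left]
      rcases eq_or_ne μ 0 with rfl | hμ
      · simp
      · have h2 : ⟪z, y⟫_ℂ = 0 := by
          have h3 := (b ⟨μ, hμ⟩).sum_repr ⟨z, hz⟩
          have h4 := congrArg (Submodule.subtype _) h3
          rw [map_sum] at h4
          simp only [map_smul, Submodule.subtype_apply] at h4
          rw [← h4, sum_inner]
          refine Finset.sum_eq_zero fun i _ => ?_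
          rw [inner_smul_left, show ⟪((b ⟨μ, hμ⟩ i : Ev μ) : H), y⟫_ℂ = 0 from hy ⟨⟨μ, hμ⟩, i⟩,
            mul_zero]
        rw [h2, mul_zero]
    have hTy : T y ∈ (⨆ μ, Ev μ)ᗮ := by
      rw [← Submodule.iInf_orthogonal, Submodule.mem_iInf]
      exact fun μ z hz => hperp μ z hz
    rw [ContinuousLinearMap.orthogonalComplement_iSup_eigenspaces_eq_bot hTc hTs,
      Submodule.mem_bot] at hTy
    have := hinner y y
    rwa [hTy, inner_zero_right, inner_self_eq_zero] at this

/-- Up to multiplication by contractions, a compact operator is a diagonal operator with respect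
to any given orthonormal sequence. -/
theorem IsCompactOperator.exists_diagonal {x : H →L[ℂ] H} (hx : IsCompactOperator x)
    {e : ℕ → H} (he : Orthonormal ℂ e) :
    ∃ (ξ : ℕ → ℝ) (D a b a' b' : H →L[ℂ] H), Tendsto ξ atTop (𝓝 0) ∧
      singularValue x = decrRearrangement ξ ∧ IsSchmidt e e (fun k => (ξ k : ℂ)) D ∧
      ‖a‖ ≤ 1 ∧ ‖b‖ ≤ 1 ∧ ‖a'‖ ≤ 1 ∧ ‖b'‖ ≤ 1 ∧ x = a * D * b ∧ D = a' * x * b' := by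
  obtain ⟨ι, u, v, c, hu, hv, hc, hxs⟩ := hx.exists_isSchmidt
  have hfin : ∀ t > 0, {i | t < c i}.Finite := fun t ht => by
    simpa [abs_of_pos (hc _)] using hxs.finite_of_isCompactOperator hu hv hx ht
  have hcount : Countable ι := by
    rw [← Set.countable_univ_iff]
    have : (Set.univ : Set ι) = ⋃ n : ℕ, {i | 1 / ((n : ℝ) + 1) < c i} := by
      ext i
      simpa using exists_nat_one_div_lt (hc i)
    rw [this]
    exact Set.countable_iUnion fun n => (hfin _ Nat.one_div_pos_of_nat).countable
  -- The coefficients are laid out along `ℕ` in arbitrary order, with zeros in the gaps; only the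
  -- rearrangement matters.
  obtain ⟨σ, hσ⟩ := exists_injective_nat ι
  set ξ : ℕ → ℝ := Function.extend σ c 0 with hξ
  have hξσ : ∀ i, ξ (σ i) = c i := fun i => hσ.extend_apply c 0 i
  have hξ0 : ∀ k, (∀ i, σ i ≠ k) → ξ k = 0 := fun k hk =>
    Function.extend_apply' _ _ _ fun ⟨i, hi⟩ => hk i hi
  have hset : ∀ t, 0 ≤ t → {k | t < |ξ k|} = σ '' {i | t < ‖(c i : ℂ)‖} := fun t ht => by
    ext k
    constructor
    · intro hk
      by_cases h : ∃ i, σ i = k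
      · obtain ⟨i, rfl⟩ := h
        refine ⟨i, ?_, rfl⟩
        simpa [hξσ] using hk
      · push Not at h
        rw [Set.mem_ofPred_eq, hξ0 k h, abs_zero] at hk
        exact absurd hk (not_lt.2 ht)
    · rintro ⟨i, hi, rfl⟩
      simpa [hξσ] using hi
  have hfin' := fun t ht => hxs.finite_of_isCompactOperator hu hv hx (t := t) ht
  have hnull : Tendsto ξ atTop (𝓝 0) :=
    tendsto_zero_iff_finite.2 fun t ht => by
      rw [hset t ht.le]
      exact (hfin' t ht).image σ
  obtain ⟨M, hM⟩ := exists_abs_le_of_tendsto hnull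
  obtain ⟨D, -, hD⟩ := IsSchmidt.exists_norm_le (c := fun k => (ξ k : ℂ)) he he
    ((abs_nonneg _).trans (hM 0)) (by simpa using hM)
  have heσ : Orthonormal ℂ (e ∘ σ) := he.comp σ hσ
  -- Partial isometries: `a` and `a'` exchange `e ∘ σ` and `u`, while `b` and `b'` exchange `v` and
  -- `e ∘ σ`.
  obtain ⟨a, ha, haS⟩ := IsSchmidt.exists_norm_le (c := fun _ => 1) hu heσ zero_le_one (by simp)
  obtain ⟨b, hb, hbS⟩ := IsSchmidt.exists_norm_le (c := fun _ => 1) heσ hv zero_le_one (by simp)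
  obtain ⟨a', ha', haS'⟩ := IsSchmidt.exists_norm_le (c := fun _ => 1) heσ hu zero_le_one (by simp)
  obtain ⟨b', hb', hbS'⟩ := IsSchmidt.exists_norm_le (c := fun _ => 1) hv heσ zero_le_one (by simp)
  have hDσ : IsSchmidt (e ∘ σ) (e ∘ σ) (fun i => (c i : ℂ)) D := by
    refine ⟨fun i => by simp [hD.apply, hξσ], fun y hy => ?_⟩
    -- `hD` only controls vectors orthogonal to all of `e`. The operator `P` built from `e ∘ σ`
    -- alone has the same diagonal along `e`, hence equals `D`.
    obtain ⟨P, -, hP⟩ := IsSchmidt.exists_norm_le (c := fun i => (c i : ℂ)) heσ heσ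
      ((abs_nonneg _).trans (hM 0)) (fun i => by simpa [hξσ] using hM (σ i))
    have : IsSchmidt e e (fun k => (ξ k : ℂ)) P := by
      refine ⟨fun k => ?_, fun z hz => hP.apply_eq_zero z fun i => hz (σ i)⟩
      by_cases h : ∃ i, σ i = k
      · obtain ⟨i, rfl⟩ := h
        simpa [hξσ] using hP.apply i
      · push Not at h
        rw [hξ0 k h, hP.apply_eq_zero (e k) fun i => he.2 (h i)]
        simp
    rw [hD.ext this]
    exact hP.apply_eq_zero y hy
  refine ⟨ξ, D, a, b, a', b', hnull, ?_, hD, ha, hb, ha', hb', ?_, ?_⟩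
  · funext n
    rw [hxs.singularValue_eq hu hv hfin', decrRearrangement]
    congr 1
    ext t
    refine and_congr_right fun ht => ?_
    rw [hset t ht, hσ.encard_image]
  · refine hxs.ext ?_
    have := IsSchmidt.mul (IsSchmidt.mul haS.apply hDσ).apply hbS
    convert this using 1
    ext i; simp
  · refine hDσ.ext ?_
    have := IsSchmidt.mul (IsSchmidt.mul haS'.apply hxs).apply hbS'
    convert this using 1
    ext i; simp

end

/-! ### Comparison of diagonal operators -/

section

open scoped InnerProductSpace
variable {H : Type*} [NormedAddCommGroup H] [InnerProductSpace ℂ H] [CompleteSpace H]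

/-- A diagonal operator is obtained by contractions from another one whose diagonal has a larger
decreasing rearrangement. -/
theorem IsSchmidt.exists_eq_mul_mul {e : ℕ → H} (he : Orthonormal ℂ e) {ξ η : ℕ → ℝ}
    (hξ : Tendsto ξ atTop (𝓝 0)) (hη : Tendsto η atTop (𝓝 0))
    (h : decrRearrangement ξ ≤ decrRearrangement η) {A B : H →L[ℂ] H}
    (hA : IsSchmidt e e (fun k => (ξ k : ℂ)) A) (hB : IsSchmidt e e (fun k => (η k : ℂ)) B) :
    ∃ a b : H →L[ℂ] H, ‖a‖ ≤ 1 ∧ ‖b‖ ≤ 1 ∧ A = a * B * b := by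
  obtain ⟨σ, hσ, hle⟩ := exists_injective_abs_le hξ hη h
  have heσ : Orthonormal ℂ (e ∘ σ) := he.comp σ hσ
  have he' : Orthonormal ℂ fun k : {k // ξ k ≠ 0} => e k := he.comp _ Subtype.val_injective
  -- `b` moves `e k` to `e (σ k)`, `B` multiplies by `η (σ k)`, and `a` moves back while correcting
  -- the factor to `ξ k`.
  obtain ⟨a, ha, haS⟩ := IsSchmidt.exists_norm_le
    (c := fun k : {k // ξ k ≠ 0} => ((ξ k / η (σ k) : ℝ) : ℂ)) he' heσ zero_le_one (fun k => by
      rw [Complex.norm_real, Real.norm_eq_abs, abs_div]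
      exact div_le_one_of_le₀ (hle k) (abs_nonneg _))
  obtain ⟨b, hb, hbS⟩ := IsSchmidt.exists_norm_le (c := fun _ => 1) heσ he' zero_le_one (by simp)
  refine ⟨a, b, ha, hb, hA.ext ⟨fun k => ?_, fun y hy => ?_⟩⟩
  · by_cases hk : ξ k = 0
    · have : b (e k) = 0 := hbS.apply_eq_zero _ fun i => he.2 fun hik => i.2 (hik ▸ hk)
      simp [mul_apply_eq_comp, this, hk]
    · have h1 := hbS.apply ⟨k, hk⟩
      have h2 := hB.apply (σ ⟨k, hk⟩)
      have h3 := haS.apply ⟨k, hk⟩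
      have hne : η (σ ⟨k, hk⟩) ≠ 0 := fun h0 => by
        have := hle ⟨k, hk⟩
        rw [h0, abs_zero] at this
        exact hk (abs_nonpos_iff.1 this)
      simp only [Function.comp_apply, one_smul] at h1 h3
      rw [mul_apply_eq_comp, mul_apply_eq_comp, h1, h2, map_smul, h3, smul_smul,
        ← Complex.ofReal_mul, mul_div_cancel₀ _ hne]
  · have : b y = 0 := hbS.apply_eq_zero _ fun i => hy i
    simp [mul_apply_eq_comp, this]

theorem exists_orthonormal_nat (hH : ¬ FiniteDimensional ℂ H) :
    ∃ e : ℕ → H, Orthonormal ℂ e := by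
  obtain ⟨w, b, hb⟩ := exists_hilbertBasis ℂ H
  have hinf : w.Infinite := by
    intro hfin
    have : Finite w := hfin
    have hfd := FiniteDimensional.span_of_finite ℂ (Set.finite_range b)
    have htop := b.dense_span
    rw [(Submodule.closed_of_finiteDimensional _).submodule_topologicalClosure_eq] at htop
    rw [htop] at hfd
    exact hH (Submodule.topEquiv (R := ℂ) (M := H)).finiteDimensional
  let φ := hinf.natEmbedding
  exact ⟨fun n => b (φ n), b.orthonormal.comp _ φ.injective⟩

/-! ### Rank-one projections and the operator norm -/

namespace IsSymmetricQuasiBanachIdeal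

variable {I : Submodule ℂ (H →L[ℂ] H)} {q : I → ℝ}

theorem exists_mem_le (hI : IsSymmetricQuasiBanachIdeal I q) {x y a b : H →L[ℂ] H} (hx : x ∈ I)
    (ha : ‖a‖ ≤ 1) (hb : ‖b‖ ≤ 1) (h : y = a * x * b) : ∃ hy : y ∈ I, q ⟨y, hy⟩ ≤ q ⟨x, hx⟩ := by
  subst h
  refine ⟨hI.mul_mem a b x hx, (hI.symmetric a b ⟨x, hx⟩).trans ?_⟩
  have h0 := hI.quasiNorm.nonneg ⟨x, hx⟩
  calc ‖a‖ * q ⟨x, hx⟩ * ‖b‖ ≤ 1 * q ⟨x, hx⟩ * 1 := by gcongr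
    _ = q ⟨x, hx⟩ := by ring

open InnerProductSpace in
-- If `x z ≠ 0` for some `x ∈ I`, compressing `x` between the rank-one operators `g ⊗ x z` and `z ⊗
-- g` yields `‖x z‖²` times the projection onto `g`.
theorem rankOne_mem_and_apply (hI : IsSymmetricQuasiBanachIdeal I q) {g : H} (hg : ‖g‖ = 1) :
    ∃ h : rankOne ℂ g g ∈ I, q ⟨rankOne ℂ g g, h⟩ = 1 := by
  have hmem : rankOne ℂ g g ∈ I := by
    obtain ⟨x, hx, hx0⟩ := I.exists_mem_ne_zero_of_ne_bot hI.ne_bot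
    obtain ⟨z, hz⟩ : ∃ z, x z ≠ 0 := by
      by_contra! h
      exact hx0 (ContinuousLinearMap.ext h)
    have := I.smul_mem ((‖x z‖ : ℂ) ^ 2)⁻¹
      (hI.mul_mem (rankOne ℂ g (x z)) (rankOne ℂ z g) x hx)
    convert this using 1
    ext y
    have hne : (‖x z‖ : ℂ) ^ 2 ≠ 0 := pow_ne_zero 2 (by simpa using hz)
    simp only [smul_apply, mul_apply_eq_comp, rankOne_apply, map_smul,
      inner_self_eq_norm_sq_to_K]
    rw [smul_smul, smul_smul]
    congr 1
    change _ = ((‖x z‖ : ℂ) ^ 2)⁻¹ * _ * (‖x z‖ : ℂ) ^ 2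
    rw [mul_right_comm, inv_mul_cancel₀ hne, one_mul]
  refine ⟨hmem, hI.normalized ⟨_, hmem⟩ ?_ ?_⟩
  · exact isStarProjection_rankOne_self hg
  · have : (rankOne ℂ g g).range = Submodule.span ℂ {g} := by
      ext y
      rw [Submodule.mem_span_singleton]
      constructor
      · rintro ⟨z, rfl⟩
        exact ⟨_, (rankOne_apply _ _ _).symm⟩
      · rintro ⟨r, rfl⟩
        refine ⟨r • g, ?_⟩
        simp [hg]
    rw [this]
    exact finrank_span_singleton (by rintro rfl; simp at hg)

open InnerProductSpace in
-- For a unit vector `g` with `z = x g ≠ 0`, the projection onto `g` equals `(‖z‖⁻² g ⊗ z) x (g ⊗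
-- g)`, whence `1 ≤ ‖z‖⁻¹ q x`.
theorem norm_le (hI : IsSymmetricQuasiBanachIdeal I q) (x : I) : ‖(x : H →L[ℂ] H)‖ ≤ q x := by
  have h0 := hI.quasiNorm.nonneg x
  refine ContinuousLinearMap.opNorm_le_of_unit_norm (𝕜 := ℂ) h0 fun g hg => ?_
  rcases eq_or_ne ((x : H →L[ℂ] H) g) 0 with hz | hz
  · rw [hz, norm_zero]; exact h0
  set z := (x : H →L[ℂ] H) g with hzdef
  have hzpos : 0 < ‖z‖ := norm_pos_iff.2 hz
  obtain ⟨hp, hq⟩ := hI.rankOne_mem_and_apply hg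
  have hsymm := hI.symmetric (((‖z‖ : ℂ) ^ 2)⁻¹ • rankOne ℂ g z) (rankOne ℂ g g) x
  have heq : (⟨_, hI.mul_mem (((‖z‖ : ℂ) ^ 2)⁻¹ • rankOne ℂ g z) (rankOne ℂ g g) x x.2⟩ : I) =
      ⟨rankOne ℂ g g, hp⟩ := by
    ext y
    have hne : (‖z‖ : ℂ) ^ 2 ≠ 0 := pow_ne_zero 2 (by simpa using hz)
    simp only [smul_apply, mul_apply_eq_comp, rankOne_apply, map_smul,
      ← hzdef, inner_self_eq_norm_sq_to_K, smul_smul]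
    congr 1
    change _ * (((‖z‖ : ℂ) ^ 2)⁻¹ * (‖z‖ : ℂ) ^ 2) = _
    rw [inv_mul_cancel₀ hne, mul_one]
  rw [heq, hq] at hsymm
  simp only [norm_smul, norm_inv, norm_pow, Complex.norm_real, norm_norm, norm_rankOne, hg] at hsymm
  have : 1 ≤ q x / ‖z‖ := by
    refine hsymm.trans_eq ?_
    field_simp
  rwa [le_div_iff₀ hzpos, one_mul] at this

end IsSymmetricQuasiBanachIdeal

end

section

open scoped InnerProductSpace
variable {H : Type*} [NormedAddCommGroup H] [InnerProductSpace ℂ H]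

/-! ## The sequence space of an ideal -/

/-- The real sequences `ξ` for which the diagonal operator with diagonal `ξ`, with respect to the
family `e`, belongs to `I`. -/
def diagonalSequences (e : ℕ → H) (I : Submodule ℂ (H →L[ℂ] H)) : Submodule ℝ (ℕ → ℝ) where
  carrier := {ξ | ∃ A ∈ I, IsSchmidt e e (fun k => (ξ k : ℂ)) A}
  zero_mem' := ⟨0, I.zero_mem, ⟨by simp, by simp⟩⟩
  add_mem' := by
    rintro ξ η ⟨A, hA, hAS⟩ ⟨B, hB, hBS⟩
    refine ⟨A + B, I.add_mem hA hB, ?_⟩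
    convert hAS.add hBS using 1
    ext k; simp
  smul_mem' := by
    rintro a ξ ⟨A, hA, hAS⟩
    refine ⟨(a : ℂ) • A, I.smul_mem _ hA, ?_⟩
    convert hAS.smul (a : ℂ) using 1
    ext k; simp

/-- The diagonal operator in `I` with diagonal `ξ`. -/
noncomputable def diagonalOperator {e : ℕ → H} {I : Submodule ℂ (H →L[ℂ] H)}
    (ξ : diagonalSequences e I) : I :=
  ⟨ξ.2.choose, ξ.2.choose_spec.1⟩

variable {e : ℕ → H} {I : Submodule ℂ (H →L[ℂ] H)} {q : I → ℝ}

theorem isSchmidt_diagonalOperator (ξ : diagonalSequences e I) :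
    IsSchmidt e e (fun k => ((ξ : ℕ → ℝ) k : ℂ)) (diagonalOperator ξ : H →L[ℂ] H) :=
  ξ.2.choose_spec.2

variable [CompleteSpace H]

theorem diagonalOperator_eq {ξ : diagonalSequences e I} {A : I}
    (hA : IsSchmidt e e (fun k => ((ξ : ℕ → ℝ) k : ℂ)) (A : H →L[ℂ] H)) :
    diagonalOperator ξ = A :=
  Subtype.ext ((isSchmidt_diagonalOperator ξ).ext hA)

theorem diagonalOperator_add (ξ η : diagonalSequences e I) :
    diagonalOperator (ξ + η) = diagonalOperator ξ + diagonalOperator η := by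
  refine diagonalOperator_eq ?_
  convert (isSchmidt_diagonalOperator ξ).add (isSchmidt_diagonalOperator η) using 1
  · ext k; simp
  · rfl

theorem diagonalOperator_smul (a : ℝ) (ξ : diagonalSequences e I) :
    diagonalOperator (a • ξ) = (a : ℂ) • diagonalOperator ξ := by
  refine diagonalOperator_eq ?_
  convert (isSchmidt_diagonalOperator ξ).smul (a : ℂ) using 1
  · ext k; simp
  · rfl

theorem diagonalOperator_sub (ξ η : diagonalSequences e I) :
    diagonalOperator (ξ - η) = diagonalOperator ξ - diagonalOperator η := by
  rw [eq_sub_iff_add_eq, ← diagonalOperator_add, sub_add_cancel]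

theorem diagonalOperator_eq_zero_iff (he : Orthonormal ℂ e) (ξ : diagonalSequences e I) :
    diagonalOperator ξ = 0 ↔ ξ = 0 := by
  constructor
  · intro h
    ext k
    have h1 := (isSchmidt_diagonalOperator ξ).apply k
    rw [h] at h1
    have h2 := (smul_eq_zero.1 h1.symm).resolve_right (he.ne_zero k)
    simpa using h2
  · rintro rfl
    simpa using diagonalOperator_smul (e := e) (I := I) 0 0

/-! ### Transfer of the ideal's properties to diagonal sequences -/

namespace IsSymmetricQuasiBanachIdeal

theorem tendsto_zero (hI : IsSymmetricQuasiBanachIdeal I q) (he : Orthonormal ℂ e)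
    (ξ : diagonalSequences e I) : Tendsto (ξ : ℕ → ℝ) atTop (𝓝 0) :=
  tendsto_zero_iff_finite.2 fun t ht => by
    simpa using (isSchmidt_diagonalOperator ξ).finite_of_isCompactOperator he he
      (hI.compact _ (diagonalOperator ξ).2) ht

/-- Yields solidity and monotonicity at once, and, applied in both directions, equality of norms for
equal rearrangements. -/
theorem exists_mem_diagonalSequences_le (hI : IsSymmetricQuasiBanachIdeal I q)
    (he : Orthonormal ℂ e) (η : diagonalSequences e I) {ξ : ℕ → ℝ} (hξ : ∃ M, ∀ k, |ξ k| ≤ M)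
    (h : decrRearrangement ξ ≤ decrRearrangement η) :
    ∃ hmem : ξ ∈ diagonalSequences e I,
      q (diagonalOperator ⟨ξ, hmem⟩) ≤ q (diagonalOperator η) := by
  have hη := hI.tendsto_zero he η
  have hξ0 := tendsto_of_decrRearrangement_le hξ hη h
  obtain ⟨M, hM⟩ := hξ
  obtain ⟨A, -, hA⟩ := IsSchmidt.exists_norm_le (c := fun k => (ξ k : ℂ)) he he
    ((abs_nonneg _).trans (hM 0)) (by simpa using hM)
  obtain ⟨a, b, ha, hb, hab⟩ :=
    IsSchmidt.exists_eq_mul_mul he hξ0 hη h hA (isSchmidt_diagonalOperator η)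
  obtain ⟨hy, hq⟩ := hI.exists_mem_le (diagonalOperator η).2 ha hb hab
  refine ⟨⟨A, hy, hA⟩, ?_⟩
  rwa [diagonalOperator_eq (A := ⟨A, hy⟩) hA]

/-- The norm is well defined: `x` has the same quasi-norm as its diagonal model `η`, and `ξ` and `η`
have the same rearrangement. -/
theorem exists_mem_diagonalSequences_eq (hI : IsSymmetricQuasiBanachIdeal I q)
    (he : Orthonormal ℂ e) (x : I) {ξ : ℕ → ℝ} (hξ : ∃ M, ∀ k, |ξ k| ≤ M)
    (h : decrRearrangement ξ = singularValue (x : H →L[ℂ] H)) :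
    ∃ hmem : ξ ∈ diagonalSequences e I, q (diagonalOperator ⟨ξ, hmem⟩) = q x := by
  obtain ⟨η, D, a, b, a', b', hη, hs, hD, ha, hb, ha', hb', h1, h2⟩ :=
    (hI.compact x x.2).exists_diagonal he
  obtain ⟨hDI, hq1⟩ := hI.exists_mem_le x.2 ha' hb' h2
  obtain ⟨_, hq2⟩ := hI.exists_mem_le hDI ha hb h1
  let η' : diagonalSequences e I := ⟨η, D, hDI, hD⟩
  have hη' : q (diagonalOperator η') = q x := by
    rw [diagonalOperator_eq (A := ⟨D, hDI⟩) hD]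
    exact le_antisymm hq1 hq2
  obtain ⟨hmem, hle⟩ := hI.exists_mem_diagonalSequences_le he η' hξ (h.trans hs).le
  obtain ⟨_, hge⟩ := hI.exists_mem_diagonalSequences_le he ⟨ξ, hmem⟩ (exists_abs_le_of_tendsto hη)
    (h.trans hs).ge
  exact ⟨hmem, (le_antisymm hle hge).trans hη'⟩

theorem quasiNorm_diagonal (hI : IsSymmetricQuasiBanachIdeal I q) (he : Orthonormal ℂ e) :
    IsQuasiNorm ℝ fun ξ : diagonalSequences e I => q (diagonalOperator ξ) where
  nonneg ξ := hI.quasiNorm.nonneg _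
  eq_zero_iff ξ := (hI.quasiNorm.eq_zero_iff _).trans (diagonalOperator_eq_zero_iff he ξ)
  smul a ξ := by
    rw [diagonalOperator_smul, hI.quasiNorm.smul]
    simp
  add_le := by
    obtain ⟨C, hC, h⟩ := hI.quasiNorm.add_le
    exact ⟨C, hC, fun ξ η => by rw [diagonalOperator_add]; exact h _ _⟩

/-- By `norm_le` the limit in `I` is also an operator norm limit, so being diagonal along `e` passes
to it pointwise. -/
theorem complete_diagonal (hI : IsSymmetricQuasiBanachIdeal I q) (he : Orthonormal ℂ e) :
    IsCompleteQuasiNorm fun ξ : diagonalSequences e I => q (diagonalOperator ξ) := by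
  intro u hu
  simp only [diagonalOperator_sub] at hu
  obtain ⟨x, hx⟩ := hI.complete _ hu
  have hnorm : Tendsto (fun n => (diagonalOperator (u n) : H →L[ℂ] H)) atTop (𝓝 (x : H →L[ℂ] H)) :=
    tendsto_iff_norm_sub_tendsto_zero.2
      (squeeze_zero (fun _ => norm_nonneg _) (fun n => hI.norm_le (diagonalOperator (u n) - x)) hx)
  have happ : ∀ y, Tendsto (fun n => (diagonalOperator (u n) : H →L[ℂ] H) y) atTop
      (𝓝 ((x : H →L[ℂ] H) y)) := fun y =>
    ((ContinuousLinearMap.apply ℂ H y).continuous.tendsto _).comp hnorm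
  -- The diagonal entries of the limit are limits of real numbers, so taking real parts loses
  -- nothing.
  let ξ : ℕ → ℝ := fun k => (⟪e k, (x : H →L[ℂ] H) (e k)⟫_ℂ).re
  have hξ : ∀ k, Tendsto (fun n => ((u n : ℕ → ℝ) k)) atTop (𝓝 (ξ k)) := fun k => by
    have h1 := (Complex.continuous_re.tendsto _).comp
      ((tendsto_const_nhds (x := e k)).inner (𝕜 := ℂ) (happ (e k)))
    refine h1.congr fun n => ?_
    rw [Function.comp_apply, (isSchmidt_diagonalOperator (u n)).apply, inner_smul_right,
      inner_self_eq_norm_sq_to_K, he.1]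
    simp
  have hS : IsSchmidt e e (fun k => (ξ k : ℂ)) (x : H →L[ℂ] H) := by
    refine ⟨fun k => tendsto_nhds_unique (happ (e k)) ?_,
      fun y hy => tendsto_nhds_unique (happ y) ?_⟩
    · simp only [(isSchmidt_diagonalOperator (u _)).apply]
      exact ((Complex.continuous_ofReal.tendsto _).comp (hξ k)).smul_const _
    · simp only [(isSchmidt_diagonalOperator (u _)).apply_eq_zero y hy]
      exact tendsto_const_nhds
  refine ⟨⟨ξ, x, x.2, hS⟩, ?_⟩
  have hξx : diagonalOperator (⟨ξ, x, x.2, hS⟩ : diagonalSequences e I) = x :=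
    diagonalOperator_eq hS
  simpa only [diagonalOperator_sub, hξx] using hx

theorem normalized_diagonal (hI : IsSymmetricQuasiBanachIdeal I q) (he : Orthonormal ℂ e) :
    ∃ h : (Pi.single 0 1 : ℕ → ℝ) ∈ diagonalSequences e I,
      q (diagonalOperator ⟨Pi.single 0 1, h⟩) = 1 := by
  obtain ⟨hp, hq⟩ := hI.rankOne_mem_and_apply (he.1 0)
  have hS : IsSchmidt e e (fun k => ((Pi.single 0 1 : ℕ → ℝ) k : ℂ))
      (InnerProductSpace.rankOne ℂ (e 0) (e 0)) := by
    refine ⟨fun k => ?_, fun y hy => by simp [hy 0]⟩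
    rw [InnerProductSpace.rankOne_apply, orthonormal_iff_ite.1 he]
    rcases eq_or_ne k 0 with rfl | hk
    · simp
    · simp [hk, hk.symm]
  exact ⟨⟨_, hp, hS⟩, by rwa [diagonalOperator_eq (A := ⟨_, hp⟩) hS]⟩

theorem isSymmetricQuasiBanachSequenceSpace (hI : IsSymmetricQuasiBanachIdeal I q)
    (he : Orthonormal ℂ e) :
    IsSymmetricQuasiBanachSequenceSpace (diagonalSequences e I)
      fun ξ => q (diagonalOperator ξ) where
  bounded ξ hξ := by
    obtain ⟨M, hM⟩ := exists_abs_le_of_tendsto (hI.tendsto_zero he ⟨ξ, hξ⟩)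
    exact memℓp_infty ⟨M, by rintro _ ⟨k, rfl⟩; exact hM k⟩
  ne_bot h := by
    obtain ⟨h1, -⟩ := hI.normalized_diagonal he
    rw [h, Submodule.mem_bot] at h1
    simpa using congrFun h1 0
  solid η hη ξ hξ h := by
    obtain ⟨M, hM⟩ := memℓp_infty_iff.1 hξ
    exact (hI.exists_mem_diagonalSequences_le he ⟨η, hη⟩ ⟨M, fun k => hM ⟨k, rfl⟩⟩ h).1
  quasiNorm := hI.quasiNorm_diagonal he
  complete := hI.complete_diagonal he
  mono ξ η h := (hI.exists_mem_diagonalSequences_le he η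
    (exists_abs_le_of_tendsto (hI.tendsto_zero he ξ)) h).2
  normalized := hI.normalized_diagonal he

theorem modulusOfConcavity_diagonal_le (hI : IsSymmetricQuasiBanachIdeal I q) :
    modulusOfConcavity (fun ξ : diagonalSequences e I => q (diagonalOperator ξ)) ≤
      modulusOfConcavity q := by
  refine csInf_le_csInf ⟨1, fun _ h => h.1⟩ hI.quasiNorm.add_le ?_
  rintro C ⟨hC, h⟩
  exact ⟨hC, fun ξ η => by simpa only [diagonalOperator_add] using h _ _⟩

theorem coe_diagonalSequences (hI : IsSymmetricQuasiBanachIdeal I q) (he : Orthonormal ℂ e) :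
    (diagonalSequences e I : Set (ℕ → ℝ)) = calkinSequences I := by
  ext ξ
  constructor
  · intro hξ
    have h0 := hI.tendsto_zero he ⟨ξ, hξ⟩
    obtain ⟨A, hA, hAS⟩ := hξ
    refine ⟨h0, A, hA, ?_⟩
    funext n
    rw [hAS.singularValue_eq he he (by simpa using tendsto_zero_iff_finite.1 h0)]
    simp [decrRearrangement]
  · rintro ⟨h0, x, hx, h⟩
    exact (hI.exists_mem_diagonalSequences_eq he ⟨x, hx⟩ (exists_abs_le_of_tendsto h0) h).1

theorem exists_singularValue_mem_eq (hI : IsSymmetricQuasiBanachIdeal I q)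
    (he : Orthonormal ℂ e) (x : I) :
    ∃ hmem : singularValue (x : H →L[ℂ] H) ∈ diagonalSequences e I,
      q (diagonalOperator ⟨_, hmem⟩) = q x := by
  obtain ⟨ξ, -, -, -, -, -, h0, hs, -⟩ := (hI.compact x x.2).exists_diagonal he
  refine hI.exists_mem_diagonalSequences_eq he x ?_ ?_
  · rw [hs]
    exact exists_abs_le_of_tendsto (tendsto_decrRearrangement h0)
  · rw [hs, decrRearrangement_decrRearrangement (exists_abs_le_of_tendsto h0)]

theorem calkinOperators_diagonalSequences (hI : IsSymmetricQuasiBanachIdeal I q)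
    (he : Orthonormal ℂ e) :
    calkinOperators H (diagonalSequences e I) = (I : Set (H →L[ℂ] H)) := by
  ext x
  constructor
  · rintro ⟨hx, hmem⟩
    obtain ⟨ξ, D, a, b, -, -, h0, hs, hD, ha, hb, -, -, h1, -⟩ := hx.exists_diagonal he
    -- Since `ξ* = s(x) = s(x)*`, solidity puts the diagonal model of `x` into `I`, and `x = a * D *
    -- b` follows it.
    obtain ⟨⟨D', hD', hDS⟩, -⟩ := hI.exists_mem_diagonalSequences_le he ⟨_, hmem⟩
      (exists_abs_le_of_tendsto h0) (by
        change _ ≤ decrRearrangement (singularValue x)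
        rw [hs, decrRearrangement_decrRearrangement (exists_abs_le_of_tendsto h0)])
    rw [h1, hD.ext hDS]
    exact hI.mul_mem a b D' hD'
  · intro hx
    exact ⟨hI.compact x hx, (hI.exists_singularValue_mem_eq he ⟨x, hx⟩).1⟩

end IsSymmetricQuasiBanachIdeal

end

theorem theorem4p1 {H : Type*} [NormedAddCommGroup H] [InnerProductSpace ℂ H] [CompleteSpace H]
    (hH : ¬ FiniteDimensional ℂ H)
    (I : Submodule ℂ (H →L[ℂ] H)) (q : I → ℝ) (hI : IsSymmetricQuasiBanachIdeal I q) :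
    ∃ (E : Submodule ℝ (ℕ → ℝ)) (N : E → ℝ),
      -- `E` is the set `E_I`, and `N` is the function `‖ξ‖ = ‖x‖_I` for any `x ∈ I`
      -- with `s(x) = ξ*`
      (E : Set (ℕ → ℝ)) = calkinSequences I ∧
      (∀ (ξ : E) (x : I), decrRearrangement ξ = singularValue (x : H →L[ℂ] H) → N ξ = q x) ∧
      -- it is a symmetric quasi-Banach sequence space in `c₀`
      IsSymmetricQuasiBanachSequenceSpace E N ∧
      (∀ ξ ∈ E, Tendsto ξ atTop (𝓝 0)) ∧
      modulusOfConcavity N ≤ modulusOfConcavity q ∧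
      -- `C_{E_I} = I`, with equal quasi-norms
      calkinOperators H E = (I : Set (H →L[ℂ] H)) ∧
      ∀ (x : I) (hx : (x : H →L[ℂ] H) ∈ calkinOperators H E),
        calkinOperatorsNorm E N ⟨(x : H →L[ℂ] H), hx⟩ = q x := by
  obtain ⟨e, he⟩ := exists_orthonormal_nat hH
  exact ⟨diagonalSequences e I, fun ξ => q (diagonalOperator ξ), hI.coe_diagonalSequences he,
    fun ξ x h => (hI.exists_mem_diagonalSequences_eq he x
      (exists_abs_le_of_tendsto (hI.tendsto_zero he ξ)) h).2,
    hI.isSymmetricQuasiBanachSequenceSpace he, fun ξ hξ => hI.tendsto_zero he ⟨ξ, hξ⟩,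
    hI.modulusOfConcavity_diagonal_le, hI.calkinOperators_diagonalSequences he,
    fun x _ => (hI.exists_singularValue_mem_eq he x).2⟩
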